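/- Let $B\to A$ be a homomorphism of associative unital rings, and let $R=A^B$ be the centraliser of $B$ in $A$ and $Z$ the centre of $A$. Assume that the extension has depth two, i.e. $A\otimes_BA$ is isomorphic to a direct summand of a finite direct sum $A\oplus\cdots\oplus A$ as a $(B,A)$-bimodule, and also (possibly with another number of summands) as an $(A,B)$-bimodule. Assume also that the extension is separable, and let $e=\sum e^1\otimes e^2\in A\otimes_BA$ be any separability element: $ae=ea$ for all $a\in A$, and $\sum e^1e^2=1$. Let $\mathcal C$ be the group $\mathrm{End}_{B,B}(A)$ of $(B,B)$-bimodule endomorphisms of $A$, made a non-unital ring by $(\alpha*\beta)(x)=\sum\alpha(xe^1)\beta(e^2)$. Conventions. A right module $M$ over a non-unital ring $S$ is firm if $M\otimes_SS\to M$, $m\otimes s\mapsto ms$, is an isomorphism; similarly for left modules; bimodules and rings are firm if they are so on both sides. A Morita context $(S,T,V,W,\tau,\sigma)$ consists of firm non-unital rings $S,T$, a firm $(S,T)$-bimodule $V$, a firm $(T,S)$-bimodule $W$ and bimodule maps $\sigma:W\otimes_SV\to T$, $\tau:V\otimes_TW\to S$ with $\sigma(w\otimes v)w'=w\,\tau(v\otimes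 w')$ and $\tau(v\otimes w)v'=v\,\sigma(w\otimes v')$. It is strict if $\sigma$ and $\tau$ are isomorphisms. Then there is a Morita context $(Z,\mathcal C,{}_ZR_{\mathcal C},{}_{\mathcal C}R_Z,\tau,\sigma)$ in which $Z$ acts on $R$ by multiplication, $\mathcal C$ acts on $R$ by $$r\cdot\alpha=\sum e^1r\,\alpha(e^2),\qquad \alpha\cdot r=\sum\alpha(e^1)\,r\,e^2,$$ and, with $\lambda(r)$ and $\rho(r)$ denoting left and right multiplication by $r$ on $A$, $$\sigma:R\otimes_ZR\to\mathcal C,\quad r\otimes r'\mapsto\lambda(r)\rho(r')=\rho(r')\lambda(r),$$ $$\tau:R\otimes_{\mathcal C}R\to Z,\quad r\otimes r'\mapsto\sum e^1rr'e^2.$$ The map $\tau$ is always an isomorphism. If moreover $B\to A$ is H-separable, i.e. $1\otimes1=\sum_ie_ir_i$ for finitely many $e_i\in A\otimes_BA$ with $ae_i=e_ia$ for all $a\in A$ and $r_i\in R$, then the Morita context is strict. -/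

import Mathlib

open scoped TensorProduct

namespace D2Morita

section Balanced

variable {S M N P : Type*} [AddCommGroup M] [AddCommGroup N] [AddCommGroup P]

/-- The subgroup of `M ⊗[ℤ] N` generated by all `m s ⊗ n - m ⊗ s n`. -/
def balSubgroup (r : M → S → M) (l : S → N → N) : AddSubgroup (M ⊗[ℤ] N) :=
  AddSubgroup.closure {t | ∃ m s n, t = r m s ⊗ₜ[ℤ] n - m ⊗ₜ[ℤ] l s n}

/-- The tensor product `M ⊗_S N` of a right `S`-module and a left `S`-module, for a possibly
noncommutative and possibly non-unital `S`; here `r m s` is `m s` and `l s n` is `s n`. -/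
abbrev BalTensor (r : M → S → M) (l : S → N → N) : Type _ :=
  (M ⊗[ℤ] N) ⧸ balSubgroup r l

/-- The pure tensor `m ⊗ n` in `M ⊗_S N`. -/
def tmul (r : M → S → M) (l : S → N → N) (m : M) (n : N) : BalTensor r l :=
  QuotientAddGroup.mk (m ⊗ₜ[ℤ] n)

/-- The additive map `M ⊗_S N → P` induced by an `S`-balanced biadditive map. -/
def BalTensor.lift {r : M → S → M} {l : S → N → N} (g : M →+ N →+ P)
    (h : ∀ m s n, g (r m s) n = g m (l s n)) : BalTensor r l →+ P :=
  QuotientAddGroup.lift (balSubgroup r l)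
    (TensorProduct.liftAddHom g (by intro k m n; simp))
    (by
      rw [balSubgroup, AddSubgroup.closure_le]
      rintro _ ⟨m, s, n, rfl⟩
      simp [h])

@[simp]
theorem BalTensor.lift_tmul {r : M → S → M} {l : S → N → N} (g : M →+ N →+ P)
    (h : ∀ m s n, g (r m s) n = g m (l s n)) (m : M) (n : N) :
    BalTensor.lift g h (tmul r l m n) = g m n := rfl

theorem tmul_balanced (r : M → S → M) (l : S → N → N) (m : M) (s : S) (n : N) :
    tmul r l (r m s) n = tmul r l m (l s n) := by
  unfold tmul
  rw [← sub_eq_zero, ← QuotientAddGroup.mk_sub, QuotientAddGroup.eq_zero_iff]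
  exact AddSubgroup.subset_closure ⟨m, s, n, rfl⟩

/-- The pure tensor as a biadditive map. -/
def tmulHom (r : M → S → M) (l : S → N → N) : M →+ N →+ BalTensor r l :=
  AddMonoidHom.mk' (fun m => AddMonoidHom.mk' (fun n => tmul r l m n)
      (fun n n' => by simp [tmul, TensorProduct.tmul_add]))
    (fun m m' => by ext n; simp [tmul, TensorProduct.add_tmul])

@[simp]
theorem tmulHom_apply (r : M → S → M) (l : S → N → N) (m : M) (n : N) :
    tmulHom r l m n = tmul r l m n := rfl

end Balanced

section NonUnital

/-- A left module over a non-unital ring. -/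
structure LeftMod (S M : Type*) [NonUnitalRing S] [AddCommGroup M] where
  act : S →+ M →+ M
  mul_act : ∀ s t m, act (s * t) m = act s (act t m)

/-- A right module over a non-unital ring; `act m s` is `m s`. -/
structure RightMod (S M : Type*) [NonUnitalRing S] [AddCommGroup M] where
  act : M →+ S →+ M
  act_mul : ∀ m s t, act m (s * t) = act (act m s) t

/-- An `(R, S)`-bimodule over non-unital rings. -/
structure Bimod (R S M : Type*) [NonUnitalRing R] [NonUnitalRing S] [AddCommGroup M] where
  left : LeftMod R M
  right : RightMod S M
  assoc : ∀ r m s, right.act (left.act r m) s = left.act r (right.act m s)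

variable {R S M N : Type*} [NonUnitalRing R] [NonUnitalRing S] [AddCommGroup M] [AddCommGroup N]

/-- `M ⊗_S N` for a right `S`-module `M` and a left `S`-module `N`. -/
abbrev ModTensor (p : RightMod S M) (q : LeftMod S N) : Type _ :=
  BalTensor (fun m s => p.act m s) (fun s n => q.act s n)

/-- The pure tensor `m ⊗ n` in `M ⊗_S N`. -/
abbrev mtmul (p : RightMod S M) (q : LeftMod S N) (m : M) (n : N) : ModTensor p q :=
  tmul (fun m s => p.act m s) (fun s n => q.act s n) m n

variable (S) in
/-- `S` as a left module over itself. -/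
def LeftMod.self : LeftMod S S where
  act := AddMonoidHom.mul
  mul_act := fun s t m => by simp [mul_assoc]

variable (S) in
/-- `S` as a right module over itself. -/
def RightMod.self : RightMod S S where
  act := AddMonoidHom.mul
  act_mul := fun m s t => by simp [mul_assoc]

/-- The map `S ⊗_S M → M`, `s ⊗ m ↦ s m`. -/
def LeftMod.actMap (q : LeftMod S M) : ModTensor (RightMod.self S) q →+ M :=
  BalTensor.lift q.act (fun s t m => q.mul_act s t m)

/-- The map `M ⊗_S S → M`, `m ⊗ s ↦ m s`. -/
def RightMod.actMap (p : RightMod S M) : ModTensor p (LeftMod.self S) →+ M :=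
  BalTensor.lift p.act (fun m s t => (p.act_mul m s t).symm)

/-- A left module `M` is firm if `S ⊗_S M → M` is an isomorphism. -/
def LeftMod.IsFirm (q : LeftMod S M) : Prop := Function.Bijective q.actMap

/-- A right module `M` is firm if `M ⊗_S S → M` is an isomorphism. -/
def RightMod.IsFirm (p : RightMod S M) : Prop := Function.Bijective p.actMap

/-- A bimodule is firm if it is firm on both sides. -/
def Bimod.IsFirm (b : Bimod R S M) : Prop := b.left.IsFirm ∧ b.right.IsFirm

variable (S) in
/-- A non-unital ring is firm if it is firm as a left and as a right module over itself. -/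
def IsFirmRing : Prop := (LeftMod.self S).IsFirm ∧ (RightMod.self S).IsFirm

end NonUnital

/-- A Morita context `(R, S, V, W, τ, σ)` between firm non-unital rings: firm bimodules
`V = _R V_S`, `W = _S W_R` and bimodule maps `σ : W ⊗_R V → S`, `τ : V ⊗_S W → R` with
`σ(w ⊗ v) w' = w τ(v ⊗ w')` and `τ(v ⊗ w) v' = v σ(w ⊗ v')`. The maps are additive, so it is
enough to state linearity and the two associativity laws on pure tensors. -/
structure MoritaContext (R S V W : Type*) [NonUnitalRing R] [NonUnitalRing S]
    [AddCommGroup V] [AddCommGroup W] where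
  firm_R : IsFirmRing R
  firm_S : IsFirmRing S
  bV : Bimod R S V
  bW : Bimod S R W
  firm_V : bV.IsFirm
  firm_W : bW.IsFirm
  σ : ModTensor bW.right bV.left →+ S
  τ : ModTensor bV.right bW.left →+ R
  σ_left : ∀ s w v, σ (mtmul _ _ (bW.left.act s w) v) = s * σ (mtmul _ _ w v)
  σ_right : ∀ w v s, σ (mtmul _ _ w (bV.right.act v s)) = σ (mtmul _ _ w v) * s
  τ_left : ∀ r v w, τ (mtmul _ _ (bV.left.act r v) w) = r * τ (mtmul _ _ v w)
  τ_right : ∀ v w r, τ (mtmul _ _ v (bW.right.act w r)) = τ (mtmul _ _ v w) * r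
  σ_τ : ∀ w v w', bW.left.act (σ (mtmul _ _ w v)) w' = bW.right.act w (τ (mtmul _ _ v w'))
  τ_σ : ∀ v w v', bV.left.act (τ (mtmul _ _ v w)) v' = bV.right.act v (σ (mtmul _ _ w v'))

/-- A Morita context is strict if `σ` and `τ` are isomorphisms. -/
def MoritaContext.IsStrict {R S V W : Type*} [NonUnitalRing R] [NonUnitalRing S]
    [AddCommGroup V] [AddCommGroup W] (K : MoritaContext R S V W) : Prop :=
  Function.Bijective K.σ ∧ Function.Bijective K.τ

section Extension

variable {B A : Type*} [Ring B] [Ring A]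

/-- `A ⊗_B A` for a ring extension `f : B → A`. -/
abbrev ExtTensor (f : B →+* A) : Type _ :=
  BalTensor (fun (a : A) (b : B) => a * f b) (fun (b : B) (a : A) => f b * a)

/-- The pure tensor `a ⊗ a'` in `A ⊗_B A`. -/
abbrev etmul (f : B →+* A) (a a' : A) : ExtTensor f :=
  tmul (fun (a : A) (b : B) => a * f b) (fun (b : B) (a : A) => f b * a) a a'

/-- The left action of `c : A` on `A ⊗_B A`: `c (a ⊗ a') = c a ⊗ a'`. -/
def lact (f : B →+* A) (c : A) : ExtTensor f →+ ExtTensor f :=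
  BalTensor.lift ((tmulHom _ _).comp (AddMonoidHom.mulLeft c))
    (fun a b a' => by
      change etmul f (c * (a * f b)) a' = etmul f (c * a) (f b * a')
      rw [← mul_assoc]
      exact tmul_balanced _ _ (c * a) b a')

/-- The right action of `c : A` on `A ⊗_B A`: `(a ⊗ a') c = a ⊗ a' c`. -/
def ract (f : B →+* A) (c : A) : ExtTensor f →+ ExtTensor f :=
  BalTensor.lift ((tmulHom _ _).compl₂ (AddMonoidHom.mulRight c))
    (fun a b a' => by
      change etmul f (a * f b) (a' * c) = etmul f a (f b * a' * c)
      rw [mul_assoc]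
      exact tmul_balanced _ _ a b (a' * c))

@[simp]
theorem lact_etmul (f : B →+* A) (c a a' : A) :
    lact f c (etmul f a a') = etmul f (c * a) a' := rfl

@[simp]
theorem ract_etmul (f : B →+* A) (c a a' : A) :
    ract f c (etmul f a a') = etmul f a (a' * c) := rfl

/-- `B → A` has depth two: `A ⊗_B A` is isomorphic to a direct summand of some finite power
`A ⊕ ⋯ ⊕ A` as a `(B, A)`-bimodule, and similarly as an `(A, B)`-bimodule. Being isomorphic to a
direct summand is expressed by bimodule maps `i`, `p` with `p ∘ i = id`. -/
structure IsDepthTwo (f : B →+* A) : Prop where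
  BA_summand : ∃ (n : ℕ) (i : ExtTensor f →+ (Fin n → A)) (p : (Fin n → A) →+ ExtTensor f),
    (∀ b t, i (lact f (f b) t) = fun k => f b * i t k) ∧
    (∀ a t, i (ract f a t) = fun k => i t k * a) ∧
    (∀ b v, p (fun k => f b * v k) = lact f (f b) (p v)) ∧
    (∀ a v, p (fun k => v k * a) = ract f a (p v)) ∧
    ∀ t, p (i t) = t
  AB_summand : ∃ (n : ℕ) (i : ExtTensor f →+ (Fin n → A)) (p : (Fin n → A) →+ ExtTensor f),
    (∀ a t, i (lact f a t) = fun k => a * i t k) ∧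
    (∀ b t, i (ract f (f b) t) = fun k => i t k * f b) ∧
    (∀ a v, p (fun k => a * v k) = lact f a (p v)) ∧
    (∀ b v, p (fun k => v k * f b) = ract f (f b) (p v)) ∧
    ∀ t, p (i t) = t

/-- The centraliser `A^B` of `B` in `A`. -/
abbrev centraliser (f : B →+* A) : Subring A := Subring.centralizer (Set.range f)

/-- `t ∈ (A ⊗_B A)^A`. -/
def IsCasimir (f : B →+* A) (t : ExtTensor f) : Prop := ∀ a, lact f a t = ract f a t

/-- `B → A` is H-separable: `1 ⊗ 1 = ∑ e_i r_i` with `e_i ∈ (A ⊗_B A)^A` and `r_i ∈ A^B`. -/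
def IsHSeparable (f : B →+* A) : Prop :=
  ∃ (n : ℕ) (e : Fin n → ExtTensor f) (r : Fin n → centraliser f),
    (∀ i, IsCasimir f (e i)) ∧ etmul f 1 1 = ∑ i, ract f (r i : A) (e i)

/-- A separability element `e = ∑ e¹_i ⊗ e²_i ∈ (A ⊗_B A)^A`, `∑ e¹_i e²_i = 1`, written as a
finite sum of pure tensors. The extension is separable if and only if there is one. -/
structure SeparabilityElement (f : B →+* A) where
  n : ℕ
  fst : Fin n → A
  snd : Fin n → A
  casimir : IsCasimir f (∑ i, etmul f (fst i) (snd i))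
  mul_eq_one : ∑ i, fst i * snd i = 1

/-- The additive group of `(B, B)`-bimodule endomorphisms of `A`. -/
def bimodEnd (f : B →+* A) : AddSubgroup (A →+ A) where
  carrier := {α | ∀ b x, α (f b * x) = f b * α x ∧ α (x * f b) = α x * f b}
  zero_mem' := fun b x => by simp
  add_mem' := fun {α β} hα hβ b x => by
    simp [(hα b x).1, (hα b x).2, (hβ b x).1, (hβ b x).2, mul_add, add_mul]
  neg_mem' := fun {α} hα b x => by simp [(hα b x).1, (hα b x).2]

theorem SeparabilityElement.sum_move {f : B →+* A} (e : SeparabilityElement f)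
    (α β : bimodEnd f) (t a : A) :
    ∑ i, α.1 (t * a * e.fst i) * β.1 (e.snd i) =
      ∑ i, α.1 (t * e.fst i) * β.1 (e.snd i * a) := by
  have h := congrArg (BalTensor.lift
    ((AddMonoidHom.mul.comp (α.1.comp (AddMonoidHom.mulLeft t))).compl₂ β.1)
    (fun a b a' => by
      simp [← mul_assoc, (α.2 b (t * a)).2, (β.2 b a').1])) (e.casimir a)
  simpa [map_sum, mul_assoc] using h

/-- The group `End_{B,B}(A)`, as the carrier of the non-unital ring with the product `*`
determined by the separability element `e`. -/
def StarEnd {f : B →+* A} (_e : SeparabilityElement f) : Type _ := bimodEnd f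

namespace StarEnd

variable {f : B →+* A} (e : SeparabilityElement f)

instance : AddCommGroup (StarEnd e) := inferInstanceAs (AddCommGroup (bimodEnd f))

variable {e}

/-- The underlying additive map `A → A`. -/
def toHom (α : StarEnd e) : A →+ A := Subtype.val (p := fun x => x ∈ bimodEnd f) α

instance : CoeFun (StarEnd e) (fun _ => A → A) := ⟨fun α => toHom α⟩

theorem ext_apply {α β : StarEnd e} (h : ∀ x, α x = β x) : α = β :=
  Subtype.ext (AddMonoidHom.ext h)

/-- The product `(α * β)(x) = ∑ α(x e¹) β(e²)`. -/
def star (α β : StarEnd e) : StarEnd e :=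
  ⟨AddMonoidHom.mk' (fun x => ∑ i, α (x * e.fst i) * β (e.snd i)) (fun x y => by
      simp [add_mul, Finset.sum_add_distrib]), fun b x => by
    have h1 : ∀ y, α (f b * y) = f b * α y := fun y => (α.2 b y).1
    have h2 : ∀ y, β (y * f b) = β y * f b := fun y => (β.2 b y).2
    constructor
    · change ∑ i, α (f b * x * e.fst i) * β (e.snd i) = f b * ∑ i, α (x * e.fst i) * β (e.snd i)
      simp [mul_assoc, h1, Finset.mul_sum]
    · change ∑ i, α (x * f b * e.fst i) * β (e.snd i) = (∑ i, α (x * e.fst i) * β (e.snd i)) * f b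
      refine (e.sum_move α β x (f b)).trans ?_
      rw [Finset.sum_mul]
      refine Finset.sum_congr rfl fun i _ => ?_
      rw [mul_assoc]
      exact congrArg _ (h2 _)⟩

theorem star_apply (α β : StarEnd e) (x : A) :
    star α β x = ∑ i, α (x * e.fst i) * β (e.snd i) := rfl

theorem add_apply (α β : StarEnd e) (x : A) : (α + β) x = α x + β x := rfl

theorem zero_apply (x : A) : (0 : StarEnd e) x = 0 := rfl

instance : NonUnitalRing (StarEnd e) :=
  { (inferInstance : AddCommGroup (StarEnd e)) with
    mul := star
    left_distrib := fun α β γ => ext_apply fun x => by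
      change star α (β + γ) x = (star α β + star α γ) x
      simp [star_apply, add_apply, mul_add, Finset.sum_add_distrib]
    right_distrib := fun α β γ => ext_apply fun x => by
      change star (α + β) γ x = (star α γ + star β γ) x
      simp [star_apply, add_apply, add_mul, Finset.sum_add_distrib]
    zero_mul := fun α => ext_apply fun x => by
      change star 0 α x = (0 : StarEnd e) x
      simp [star_apply, zero_apply]
    mul_zero := fun α => ext_apply fun x => by
      change star α 0 x = (0 : StarEnd e) x
      simp [star_apply, zero_apply]
    mul_assoc := fun α β γ => ext_apply fun x => by
      change star (star α β) γ x = star α (star β γ) x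
      have h : ∀ a, ∑ i, α (x * a * e.fst i) * β (e.snd i) =
          ∑ i, α (x * e.fst i) * β (e.snd i * a) := fun a => e.sum_move α β x a
      simp only [star_apply, h, Finset.sum_mul, Finset.mul_sum]
      rw [Finset.sum_comm]
      simp only [mul_assoc] }

theorem mul_apply (α β : StarEnd e) (x : A) :
    (α * β) x = ∑ i, α (x * e.fst i) * β (e.snd i) := rfl

end StarEnd

end Extension

end D2Morita

namespace D2Morita

section Inverse

variable {S M N P : Type*} [AddCommGroup M] [AddCommGroup N] [AddCommGroup P]

theorem BalTensor.addHom_ext {r : M → S → M} {l : S → N → N} {φ ψ : BalTensor r l →+ P}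
    (h : ∀ m n, φ (tmul r l m n) = ψ (tmul r l m n)) : φ = ψ := by
  refine QuotientAddGroup.addMonoidHom_ext _ (AddMonoidHom.ext fun t => ?_)
  induction t using TensorProduct.induction_on with
  | zero => simp
  | tmul m n => exact h m n
  | add x y hx hy => rw [map_add, map_add, hx, hy]

theorem BalTensor.bijective_of_inverse {r : M → S → M} {l : S → N → N}
    (φ : BalTensor r l →+ P) (ψ : P →+ BalTensor r l)
    (h₁ : ∀ m n, ψ (φ (tmul r l m n)) = tmul r l m n) (h₂ : ∀ p, φ (ψ p) = p) :
    Function.Bijective φ := by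
  have h : ψ.comp φ = AddMonoidHom.id _ := BalTensor.addHom_ext h₁
  exact Function.bijective_iff_has_inverse.2 ⟨ψ, fun t => DFunLike.congr_fun h t, h₂⟩

end Inverse

section DualBasis

variable {S M : Type*} [NonUnitalRing S] [AddCommGroup M]

/-- A left module with a finite dual basis is firm. -/
theorem LeftMod.isFirm_of_dualBasis (q : LeftMod S M) {n : ℕ} (T : Fin n → M →+ S)
    (m : Fin n → M) (hT : ∀ k s x, T k (q.act s x) = s * T k x)
    (h : ∀ x, ∑ k, q.act (T k x) (m k) = x) : q.IsFirm := by
  refine BalTensor.bijective_of_inverse q.actMap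
    (∑ k, ((tmulHom _ _).flip (m k)).comp (T k)) (fun s x => ?_) (fun x => ?_)
  · refine Eq.trans ?_ (congrArg (tmulHom _ _ s) (h x))
    rw [show q.actMap (tmul _ _ s x) = q.act s x from rfl]
    simp only [AddMonoidHom.finsetSum_apply,
      AddMonoidHom.comp_apply, AddMonoidHom.flip_apply, hT, map_sum]
    exact Finset.sum_congr rfl fun k _ => tmul_balanced _ _ s (T k x) (m k)
  · simp only [AddMonoidHom.finsetSum_apply, AddMonoidHom.comp_apply, AddMonoidHom.flip_apply,
      tmulHom_apply, map_sum]
    exact h x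

/-- A right module with a finite dual basis is firm. -/
theorem RightMod.isFirm_of_dualBasis (p : RightMod S M) {n : ℕ} (T : Fin n → M →+ S)
    (m : Fin n → M) (hT : ∀ k x s, T k (p.act x s) = T k x * s)
    (h : ∀ x, ∑ k, p.act (m k) (T k x) = x) : p.IsFirm := by
  refine BalTensor.bijective_of_inverse p.actMap
    (∑ k, (tmulHom _ _ (m k)).comp (T k)) (fun x s => ?_) (fun x => ?_)
  · refine Eq.trans ?_ (congrArg (fun y => tmulHom _ _ y s) (h x))
    rw [show p.actMap (tmul _ _ x s) = p.act x s from rfl]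
    simp only [AddMonoidHom.finsetSum_apply, AddMonoidHom.comp_apply, hT, map_sum]
    exact Finset.sum_congr rfl fun k _ => (tmul_balanced _ _ (m k) (T k x) s).symm
  · simp only [AddMonoidHom.finsetSum_apply, AddMonoidHom.comp_apply, tmulHom_apply, map_sum]
    exact h x

theorem isFirmRing_of_one (R : Type*) [Ring R] : IsFirmRing R :=
  ⟨LeftMod.isFirm_of_dualBasis _ (n := 1) (fun _ => AddMonoidHom.id R) (fun _ => 1)
      (fun _ _ _ => rfl) (fun x => by simp [LeftMod.self]),
    RightMod.isFirm_of_dualBasis _ (n := 1) (fun _ => AddMonoidHom.id R) (fun _ => 1)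
      (fun _ _ _ => rfl) (fun x => by simp [RightMod.self])⟩

/-- A unital left module is firm. -/
theorem LeftMod.isFirm_of_one {R : Type*} [Ring R] (q : LeftMod R M)
    (h : ∀ x, q.act 1 x = x) : q.IsFirm := by
  refine BalTensor.bijective_of_inverse q.actMap (tmulHom _ _ 1) (fun s x => ?_) (fun x => ?_)
  · exact (tmul_balanced _ _ (1 : R) s x).symm.trans (by simp [RightMod.self])
  · exact h x

/-- A unital right module is firm. -/
theorem RightMod.isFirm_of_one {R : Type*} [Ring R] (p : RightMod R M)
    (h : ∀ x, p.act x 1 = x) : p.IsFirm := by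
  refine BalTensor.bijective_of_inverse p.actMap ((tmulHom _ _).flip 1) (fun x s => ?_)
    (fun x => ?_)
  · exact (tmul_balanced _ _ x s (1 : R)).trans (by simp [LeftMod.self])
  · exact h x

end DualBasis

section Extension

variable {B A : Type*} [Ring B] [Ring A] {f : B →+* A}

theorem centraliser_comm (r : centraliser f) (b : B) : f b * (r : A) = r * f b :=
  Subring.mem_centralizer_iff.1 r.2 _ ⟨b, rfl⟩

theorem mem_centraliser {a : A} (h : ∀ b, f b * a = a * f b) : a ∈ centraliser f :=
  Subring.mem_centralizer_iff.2 (by rintro _ ⟨b, rfl⟩; exact h b)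

theorem center_comm (z : Subring.center A) (a : A) : a * (z : A) = z * a :=
  Subring.mem_center_iff.1 z.2 a

/-- The identity as a bimodule endomorphism. -/
def bimodEndId (f : B →+* A) : bimodEnd f := ⟨AddMonoidHom.id A, fun _ _ => ⟨rfl, rfl⟩⟩

/-- The map `A ⊗_B A → A`, `a ⊗ a' ↦ α(x a) r β(a' y)`. -/
def sandwich (α β : bimodEnd f) (r : centraliser f) (x y : A) : ExtTensor f →+ A :=
  BalTensor.lift
    ((AddMonoidHom.mul.comp ((AddMonoidHom.mulRight (r : A)).comp
      (α.1.comp (AddMonoidHom.mulLeft x)))).compl₂ (β.1.comp (AddMonoidHom.mulRight y)))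
    (fun a b a' => by
      simp only [AddMonoidHom.compl₂_apply, AddMonoidHom.comp_apply, AddMonoidHom.coe_mulLeft,
        AddMonoidHom.coe_mulRight, AddMonoidHom.mul_apply]
      rw [← mul_assoc x, (α.2 b _).2, mul_assoc (f b), (β.2 b _).1, mul_assoc (α.1 _),
        centraliser_comm]
      simp only [mul_assoc])

theorem sandwich_etmul (α β : bimodEnd f) (r : centraliser f) (x y a a' : A) :
    sandwich α β r x y (etmul f a a') = α.1 (x * a) * r * β.1 (a' * y) := rfl

theorem sandwich_lact (α β : bimodEnd f) (r : centraliser f) (x y c : A) (t : ExtTensor f) :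
    sandwich α β r x y (lact f c t) = sandwich α β r (x * c) y t := by
  refine DFunLike.congr_fun (f := (sandwich α β r x y).comp (lact f c))
    (BalTensor.addHom_ext fun a a' => ?_) t
  change α.1 (x * (c * a)) * r * β.1 (a' * y) = α.1 (x * c * a) * r * β.1 (a' * y)
  rw [mul_assoc x]

theorem sandwich_ract (α β : bimodEnd f) (r : centraliser f) (x y c : A) (t : ExtTensor f) :
    sandwich α β r x y (ract f c t) = sandwich α β r x (c * y) t := by
  refine DFunLike.congr_fun (f := (sandwich α β r x y).comp (ract f c))
    (BalTensor.addHom_ext fun a a' => ?_) t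
  change α.1 (x * a) * r * β.1 (a' * c * y) = α.1 (x * a) * r * β.1 (a' * (c * y))
  rw [mul_assoc a']

theorem sandwich_mul_left (α β : bimodEnd f) (r : centraliser f) (x y : A) (w : A)
    (α' : bimodEnd f) (x' : A) (h : ∀ a, α'.1 (x' * a) = w * α.1 (x * a)) (t : ExtTensor f) :
    sandwich α' β r x' y t = w * sandwich α β r x y t := by
  refine DFunLike.congr_fun (g := (AddMonoidHom.mulLeft w).comp (sandwich α β r x y))
    (BalTensor.addHom_ext fun a a' => ?_) t
  change α'.1 (x' * a) * r * β.1 (a' * y) = w * (α.1 (x * a) * r * β.1 (a' * y))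
  rw [h]; simp only [mul_assoc]

theorem sandwich_mul_right (α β : bimodEnd f) (r : centraliser f) (x y : A) (w : A)
    (β' : bimodEnd f) (y' : A) (h : ∀ a, β'.1 (a * y') = β.1 (a * y) * w) (t : ExtTensor f) :
    sandwich α β' r x y' t = sandwich α β r x y t * w := by
  refine DFunLike.congr_fun (g := (AddMonoidHom.mulRight w).comp (sandwich α β r x y))
    (BalTensor.addHom_ext fun a a' => ?_) t
  change α.1 (x * a) * r * β'.1 (a' * y') = α.1 (x * a) * r * β.1 (a' * y) * w
  rw [h]; simp only [mul_assoc]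

/-- `B`-central tensors give bimodule endomorphisms `x ↦ ∑ α(x t¹) t²`. -/
def contractRight (t : ExtTensor f) (ht : ∀ b, lact f (f b) t = ract f (f b) t)
    (α : bimodEnd f) : bimodEnd f :=
  ⟨AddMonoidHom.mk' (fun x => sandwich α (bimodEndId f) 1 x 1 t) (fun x y => by
      refine DFunLike.congr_fun (f := sandwich α (bimodEndId f) 1 (x + y) 1)
        (g := sandwich α (bimodEndId f) 1 x 1 + sandwich α (bimodEndId f) 1 y 1)
        (BalTensor.addHom_ext fun a a' => ?_) t
      simp only [AddMonoidHom.add_apply, sandwich_etmul, add_mul, map_add]), fun b x => by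
    constructor
    · exact sandwich_mul_left _ _ _ _ _ _ _ _ (fun a => by rw [mul_assoc, (α.2 b _).1]) t
    · change sandwich α (bimodEndId f) 1 (x * f b) 1 t = sandwich α (bimodEndId f) 1 x 1 t * f b
      rw [← sandwich_lact, ht, sandwich_ract]
      exact sandwich_mul_right _ _ _ _ _ _ _ _ (fun a => by simp [bimodEndId]) t⟩

/-- `B`-central tensors give bimodule endomorphisms `x ↦ ∑ t¹ α(t² x)`. -/
def contractLeft (t : ExtTensor f) (ht : ∀ b, lact f (f b) t = ract f (f b) t)
    (α : bimodEnd f) : bimodEnd f :=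
  ⟨AddMonoidHom.mk' (fun x => sandwich (bimodEndId f) α 1 1 x t) (fun x y => by
      refine DFunLike.congr_fun (f := sandwich (bimodEndId f) α 1 1 (x + y))
        (g := sandwich (bimodEndId f) α 1 1 x + sandwich (bimodEndId f) α 1 1 y)
        (BalTensor.addHom_ext fun a a' => ?_) t
      simp only [AddMonoidHom.add_apply, sandwich_etmul, mul_add, map_add]), fun b x => by
    constructor
    · change sandwich (bimodEndId f) α 1 1 (f b * x) t = f b * sandwich (bimodEndId f) α 1 1 x t
      rw [← sandwich_ract, ← ht, sandwich_lact]
      exact sandwich_mul_left _ _ _ _ _ _ _ _ (fun a => by simp [bimodEndId]) t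
    · exact sandwich_mul_right _ _ _ _ _ _ _ _ (fun a => by rw [← mul_assoc, (α.2 b _).2]) t⟩

theorem IsDepthTwo.exists_rightQuasibasis (h : IsDepthTwo f) :
    ∃ (n : ℕ) (β : Fin n → bimodEnd f) (c : Fin n → ExtTensor f),
      (∀ k b, lact f (f b) (c k) = ract f (f b) (c k)) ∧
      ∀ a, etmul f a 1 = ∑ k, ract f ((β k).1 a) (c k) := by
  obtain ⟨n, i, p, hil, hir, hpl, hpr, hpi⟩ := h.BA_summand
  refine ⟨n, fun k => ⟨AddMonoidHom.mk' (fun a => i (etmul f a 1) k) fun a a' => ?_,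
    fun b x => ⟨?_, ?_⟩⟩, fun k => p (Pi.single k 1), fun k b => ?_, fun a => ?_⟩
  · have : etmul f (a + a') 1 = etmul f a 1 + etmul f a' 1 :=
      DFunLike.congr_fun (map_add (tmulHom _ _) a a') 1
    simp [this]
  · exact congrFun (hil b (etmul f x 1)) k
  · change i (etmul f (x * f b) 1) k = i (etmul f x 1) k * f b
    have : etmul f (x * f b) 1 = ract f (f b) (etmul f x 1) := by
      rw [ract_etmul]
      exact (tmul_balanced _ _ x b 1).trans (by simp)
    rw [this, hir]
  · rw [← hpl, ← hpr]
    congr 1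
    ext j
    by_cases hj : j = k
    · subst hj; simp
    · simp [Pi.single_eq_of_ne hj]
  · conv_lhs => rw [← hpi (etmul f a 1), ← Finset.univ_sum_single (i (etmul f a 1)), map_sum]
    refine Finset.sum_congr rfl fun k _ => ?_
    rw [← hpr]
    congr 1
    ext j
    by_cases hj : j = k
    · subst hj; simp
    · simp [Pi.single_eq_of_ne hj]

theorem IsDepthTwo.exists_leftQuasibasis (h : IsDepthTwo f) :
    ∃ (n : ℕ) (γ : Fin n → bimodEnd f) (c : Fin n → ExtTensor f),
      (∀ k b, lact f (f b) (c k) = ract f (f b) (c k)) ∧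
      ∀ a, etmul f 1 a = ∑ k, lact f ((γ k).1 a) (c k) := by
  obtain ⟨n, i, p, hil, hir, hpl, hpr, hpi⟩ := h.AB_summand
  refine ⟨n, fun k => ⟨AddMonoidHom.mk' (fun a => i (etmul f 1 a) k) fun a a' => ?_,
    fun b x => ⟨?_, ?_⟩⟩, fun k => p (Pi.single k 1), fun k b => ?_, fun a => ?_⟩
  · have : etmul f 1 (a + a') = etmul f 1 a + etmul f 1 a' := map_add (tmulHom _ _ 1) a a'
    simp [this]
  · change i (etmul f 1 (f b * x)) k = f b * i (etmul f 1 x) k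
    have : etmul f 1 (f b * x) = lact f (f b) (etmul f 1 x) := by
      rw [lact_etmul]
      exact (tmul_balanced _ _ 1 b x).symm.trans (by simp)
    rw [this, hil]
  · exact congrFun (hir b (etmul f 1 x)) k
  · rw [← hpl, ← hpr]
    congr 1
    ext j
    by_cases hj : j = k
    · subst hj; simp
    · simp [Pi.single_eq_of_ne hj]
  · conv_lhs => rw [← hpi (etmul f 1 a), ← Finset.univ_sum_single (i (etmul f 1 a)), map_sum]
    refine Finset.sum_congr rfl fun k _ => ?_
    rw [← hpl]
    congr 1
    ext j
    by_cases hj : j = k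
    · subst hj; simp
    · simp [Pi.single_eq_of_ne hj]

end Extension

section Context

variable {B A : Type*} [Ring B] [Ring A] {f : B →+* A} (e : SeparabilityElement f)

theorem SeparabilityElement.sum_sandwich (α β : bimodEnd f) (r : centraliser f) (x y c : A) :
    ∑ i, α.1 (x * c * e.fst i) * r * β.1 (e.snd i * y) =
      ∑ i, α.1 (x * e.fst i) * r * β.1 (e.snd i * (c * y)) := by
  have h := congrArg (sandwich α β r x y) (e.casimir c)
  rw [sandwich_lact, sandwich_ract] at h
  simpa only [map_sum, sandwich_etmul] using h

variable {e}

/-- An element of `StarEnd e` as a bimodule endomorphism. -/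
def StarEnd.toBimodEnd (α : StarEnd e) : bimodEnd f := α

theorem StarEnd.map_mul_left (α : StarEnd e) (b : B) (x : A) : α (f b * x) = f b * α x :=
  (α.2 b x).1

theorem StarEnd.map_mul_right (α : StarEnd e) (b : B) (x : A) : α (x * f b) = α x * f b :=
  (α.2 b x).2

theorem SeparabilityElement.sum_fst_move (α : StarEnd e) (r : centraliser f) (c : A) :
    ∑ i, α (c * e.fst i) * r * e.snd i = (∑ i, α (e.fst i) * r * e.snd i) * c := by
  have h := e.sum_sandwich α.toBimodEnd (bimodEndId f) r 1 1 c
  simp only [one_mul, mul_one] at h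
  refine h.trans ?_
  rw [Finset.sum_mul]
  exact Finset.sum_congr rfl fun i _ => (mul_assoc _ _ _).symm

theorem SeparabilityElement.sum_snd_move (α : StarEnd e) (r : centraliser f) (c : A) :
    ∑ i, e.fst i * r * α (e.snd i * c) = c * ∑ i, e.fst i * r * α (e.snd i) := by
  have h := e.sum_sandwich (bimodEndId f) α.toBimodEnd r 1 1 c
  simp only [one_mul, mul_one] at h
  refine h.symm.trans ?_
  rw [Finset.mul_sum]
  exact Finset.sum_congr rfl fun i _ => by
    change c * e.fst i * r * α (e.snd i) = _
    simp only [mul_assoc]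

theorem SeparabilityElement.sum_move_center (e : SeparabilityElement f) (r : centraliser f)
    (c : A) : c * ∑ i, e.fst i * r * e.snd i = (∑ i, e.fst i * r * e.snd i) * c := by
  have h := e.sum_sandwich (bimodEndId f) (bimodEndId f) r 1 1 c
  simp only [one_mul, mul_one] at h
  rw [Finset.mul_sum, Finset.sum_mul]
  refine (Finset.sum_congr rfl fun i _ => ?_).trans (h.trans (Finset.sum_congr rfl fun i _ => ?_))
  · change _ = c * e.fst i * r * e.snd i
    simp only [mul_assoc]
  · exact (mul_assoc _ _ _).symm

/-- The additive map `α ↦ (x ↦ ∑ α(x t¹) t²)` for a `B`-central tensor `t`. -/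
def StarEnd.contractRight (t : ExtTensor f) (ht : ∀ b, lact f (f b) t = ract f (f b) t) :
    StarEnd e →+ StarEnd e :=
  AddMonoidHom.mk' (fun α => D2Morita.contractRight t ht α.toBimodEnd) fun α α' =>
    StarEnd.ext_apply fun x => by
      refine DFunLike.congr_fun (f := sandwich (α + α').toBimodEnd (bimodEndId f) 1 x 1)
        (g := sandwich α.toBimodEnd (bimodEndId f) 1 x 1 +
          sandwich α'.toBimodEnd (bimodEndId f) 1 x 1)
        (BalTensor.addHom_ext fun a a' => ?_) t
      change (α (x * a) + α' (x * a)) * _ * _ = α (x * a) * _ * _ + α' (x * a) * _ * _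
      simp only [add_mul]

/-- The additive map `α ↦ (x ↦ ∑ t¹ α(t² x))` for a `B`-central tensor `t`. -/
def StarEnd.contractLeft (t : ExtTensor f) (ht : ∀ b, lact f (f b) t = ract f (f b) t) :
    StarEnd e →+ StarEnd e :=
  AddMonoidHom.mk' (fun α => D2Morita.contractLeft t ht α.toBimodEnd) fun α α' =>
    StarEnd.ext_apply fun x => by
      refine DFunLike.congr_fun (f := sandwich (bimodEndId f) (α + α').toBimodEnd 1 1 x)
        (g := sandwich (bimodEndId f) α.toBimodEnd 1 1 x +
          sandwich (bimodEndId f) α'.toBimodEnd 1 1 x)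
        (BalTensor.addHom_ext fun a a' => ?_) t
      change _ * (α (a' * x) + α' (a' * x)) = _ * α (a' * x) + _ * α' (a' * x)
      rw [mul_add]

theorem StarEnd.contractRight_mul (t : ExtTensor f)
    (ht : ∀ b, lact f (f b) t = ract f (f b) t) (s α : StarEnd e) :
    contractRight t ht (s * α) = s * contractRight t ht α := by
  refine StarEnd.ext_apply fun x => ?_
  refine DFunLike.congr_fun (f := sandwich (s * α).toBimodEnd (bimodEndId f) 1 x 1)
    (g := ∑ i, (AddMonoidHom.mulLeft (s (x * e.fst i))).comp
      (sandwich α.toBimodEnd (bimodEndId f) 1 (e.snd i) 1))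
    (BalTensor.addHom_ext fun a a' => ?_) t |>.trans ?_
  · rw [AddMonoidHom.finsetSum_apply]
    change (∑ i, s (x * a * e.fst i) * α (e.snd i)) * 1 * (a' * 1) =
      ∑ i, s (x * e.fst i) * (α (e.snd i * a) * 1 * (a' * 1))
    have h := e.sum_move s α x a
    change ∑ i, s (x * a * e.fst i) * α (e.snd i) =
      ∑ i, s (x * e.fst i) * α (e.snd i * a) at h
    rw [h]
    simp only [mul_one, Finset.sum_mul, mul_assoc]
  · rw [AddMonoidHom.finsetSum_apply]
    rfl

theorem StarEnd.contractLeft_mul (t : ExtTensor f)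
    (ht : ∀ b, lact f (f b) t = ract f (f b) t) (α s : StarEnd e) :
    contractLeft t ht (α * s) = contractLeft t ht α * s := by
  refine StarEnd.ext_apply fun x => ?_
  refine DFunLike.congr_fun (f := sandwich (bimodEndId f) (α * s).toBimodEnd 1 1 x)
    (g := ∑ i, (AddMonoidHom.mulRight (s (e.snd i))).comp
      (sandwich (bimodEndId f) α.toBimodEnd 1 1 (x * e.fst i)))
    (BalTensor.addHom_ext fun a a' => ?_) t |>.trans ?_
  · rw [AddMonoidHom.finsetSum_apply]
    change 1 * a * 1 * (∑ i, α (a' * x * e.fst i) * s (e.snd i)) =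
      ∑ i, 1 * a * 1 * α (a' * (x * e.fst i)) * s (e.snd i)
    simp only [Finset.mul_sum, mul_assoc]
  · rw [AddMonoidHom.finsetSum_apply]
    rfl

theorem StarEnd.sum_apply {n : ℕ} (g : Fin n → StarEnd e) (x : A) : (∑ k, g k) x = ∑ k, g k x :=
  map_sum (AddMonoidHom.mk' (fun α : StarEnd e => α x) fun _ _ => rfl) g _

theorem StarEnd.sum_contractRight_mul {n : ℕ} (β : Fin n → StarEnd e) (c : Fin n → ExtTensor f)
    (hc : ∀ k b, lact f (f b) (c k) = ract f (f b) (c k))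
    (hβ : ∀ a, etmul f a 1 = ∑ k, ract f (β k a) (c k)) (α : StarEnd e) :
    ∑ k, contractRight (c k) (hc k) α * β k = α := by
  refine StarEnd.ext_apply fun x => ?_
  have key : ∀ a a', ∑ k, contractRight (c k) (hc k) α a * β k a' = α (a * a') := fun a a' => by
    have h := congrArg (sandwich α.toBimodEnd (bimodEndId f) 1 a 1) (hβ a')
    rw [map_sum] at h
    simp only [sandwich_ract] at h
    change α (a * a') * 1 * (1 * 1) = _ at h
    simp only [mul_one] at h
    rw [h]
    exact Finset.sum_congr rfl fun k _ =>
      (sandwich_mul_right _ _ _ _ _ _ _ _ (fun a => by simp [bimodEndId]) _).symm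
  rw [StarEnd.sum_apply]
  simp only [StarEnd.mul_apply]
  rw [Finset.sum_comm]
  simp only [key, mul_assoc]
  rw [← map_sum, ← Finset.mul_sum, e.mul_eq_one, mul_one]

theorem StarEnd.sum_mul_contractLeft {n : ℕ} (γ : Fin n → StarEnd e) (c : Fin n → ExtTensor f)
    (hc : ∀ k b, lact f (f b) (c k) = ract f (f b) (c k))
    (hγ : ∀ a, etmul f 1 a = ∑ k, lact f (γ k a) (c k)) (α : StarEnd e) :
    ∑ k, γ k * contractLeft (c k) (hc k) α = α := by
  refine StarEnd.ext_apply fun x => ?_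
  have key : ∀ a a', ∑ k, γ k a * contractLeft (c k) (hc k) α a' = α (a * a') := fun a a' => by
    have h := congrArg (sandwich (bimodEndId f) α.toBimodEnd 1 1 a') (hγ a)
    rw [map_sum] at h
    simp only [sandwich_lact] at h
    change 1 * 1 * 1 * α (a * a') = _ at h
    simp only [one_mul] at h
    rw [h]
    exact Finset.sum_congr rfl fun k _ =>
      (sandwich_mul_left _ _ _ _ _ _ _ _ (fun a => by simp [bimodEndId]) _).symm
  rw [StarEnd.sum_apply]
  simp only [StarEnd.mul_apply]
  rw [Finset.sum_comm]
  simp only [key, mul_assoc]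
  rw [← map_sum, ← Finset.mul_sum, e.mul_eq_one, mul_one]

theorem isFirmRing_starEnd (hD2 : IsDepthTwo f) : IsFirmRing (StarEnd e) := by
  constructor
  · obtain ⟨n, β, c, hc, hβ⟩ := hD2.exists_rightQuasibasis
    exact LeftMod.isFirm_of_dualBasis _ (fun k => StarEnd.contractRight (c k) (hc k)) β
      (fun k s α => StarEnd.contractRight_mul _ _ s α)
      (fun α => StarEnd.sum_contractRight_mul (e := e) β c hc hβ α)
  · obtain ⟨n, γ, c, hc, hγ⟩ := hD2.exists_leftQuasibasis
    exact RightMod.isFirm_of_dualBasis _ (fun k => StarEnd.contractLeft (c k) (hc k)) γ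
      (fun k α s => StarEnd.contractLeft_mul _ _ α s)
      (fun α => StarEnd.sum_mul_contractLeft (e := e) γ c hc hγ α)

variable (e)

/-- The right action `r · α = ∑ e¹ r α(e²)`. -/
def rightStarMod : RightMod (StarEnd e) (centraliser f) where
  act := AddMonoidHom.mk' (fun r => AddMonoidHom.mk'
      (fun α : StarEnd e => (⟨∑ i, e.fst i * r * α (e.snd i), mem_centraliser fun b => by
        rw [← e.sum_snd_move, Finset.sum_mul]
        simp only [StarEnd.map_mul_right, mul_assoc]⟩ : centraliser f))
      fun α β => Subtype.ext (by
        simp [StarEnd.add_apply, mul_add, Finset.sum_add_distrib]))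
    fun r r' => AddMonoidHom.ext fun α => Subtype.ext (by
      simp [mul_add, add_mul, Finset.sum_add_distrib])
  act_mul r α β := Subtype.ext (by
    change ∑ i, e.fst i * r * (∑ j, α (e.snd i * e.fst j) * β (e.snd j)) =
      ∑ j, e.fst j * (∑ i, e.fst i * r * α (e.snd i)) * β (e.snd j)
    simp only [← e.sum_snd_move, Finset.mul_sum, Finset.sum_mul]
    rw [Finset.sum_comm]
    simp only [mul_assoc])

/-- The left action `α · r = ∑ α(e¹) r e²`. -/
def leftStarMod : LeftMod (StarEnd e) (centraliser f) where
  act := AddMonoidHom.mk' (fun α : StarEnd e => AddMonoidHom.mk'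
      (fun r => (⟨∑ i, α (e.fst i) * r * e.snd i, mem_centraliser fun b => by
        rw [← e.sum_fst_move, Finset.mul_sum]
        simp only [StarEnd.map_mul_left, mul_assoc]⟩ : centraliser f))
      fun r r' => Subtype.ext (by
        simp [mul_add, add_mul, Finset.sum_add_distrib]))
    fun α β => AddMonoidHom.ext fun r => Subtype.ext (by
      simp [StarEnd.add_apply, add_mul, Finset.sum_add_distrib])
  mul_act α β r := Subtype.ext (by
    change ∑ i, (∑ j, α (e.fst i * e.fst j) * β (e.snd j)) * r * e.snd i =
      ∑ j, α (e.fst j) * (∑ i, β (e.fst i) * r * e.snd i) * e.snd j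
    have h : ∀ a, ∑ j, α (a * e.fst j) * β (e.snd j) = ∑ j, α (e.fst j) * β (e.snd j * a) :=
      fun a => by
        have h := e.sum_move α β 1 a
        simp only [one_mul] at h
        exact h
    simp only [h]
    have h' : ∀ j, (∑ i, β (e.fst i) * r * e.snd i) * e.snd j =
        ∑ i, β (e.snd j * e.fst i) * r * e.snd i := fun j => (e.sum_fst_move β r _).symm
    simp only [mul_assoc _ (∑ i, β (e.fst i) * r * e.snd i), h']
    simp only [Finset.mul_sum, Finset.sum_mul]
    rw [Finset.sum_comm]
    simp only [mul_assoc])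

theorem rightStarMod_act (r : centraliser f) (α : StarEnd e) :
    ((rightStarMod e).act r α : A) = ∑ i, e.fst i * r * α (e.snd i) := rfl

theorem leftStarMod_act (α : StarEnd e) (r : centraliser f) :
    ((leftStarMod e).act α r : A) = ∑ i, α (e.fst i) * r * e.snd i := rfl

variable (f) in
/-- A central element, as an element of the centraliser. -/
def centerToCentraliser : Subring.center A →+* centraliser f :=
  Subring.inclusion (Subring.center_le_centralizer _)

/-- The bimodule `R` over `Z` and `StarEnd e`. -/
def bimodZStar : Bimod (Subring.center A) (StarEnd e) (centraliser f) where
  left :=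
    { act := AddMonoidHom.mul.comp (centerToCentraliser f).toAddMonoidHom
      mul_act := fun s t m => by
        change centerToCentraliser f (s * t) * m = _ * (_ * m)
        rw [map_mul, mul_assoc]; rfl }
  right := rightStarMod e
  assoc z r α := Subtype.ext (by
    change ∑ i, e.fst i * (z * r) * α (e.snd i) = z * ∑ i, e.fst i * r * α (e.snd i)
    rw [Finset.mul_sum]
    refine Finset.sum_congr rfl fun i _ => ?_
    rw [← mul_assoc (e.fst i), center_comm]
    simp only [mul_assoc])

/-- The bimodule `R` over `StarEnd e` and `Z`. -/
def bimodStarZ : Bimod (StarEnd e) (Subring.center A) (centraliser f) where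
  left := leftStarMod e
  right :=
    { act := AddMonoidHom.mul.compl₂ (centerToCentraliser f).toAddMonoidHom
      act_mul := fun m s t => by
        change m * centerToCentraliser f (s * t) = m * _ * _
        rw [map_mul, mul_assoc]; rfl }
  assoc α r z := Subtype.ext (by
    change (∑ i, α (e.fst i) * r * e.snd i) * z = ∑ i, α (e.fst i) * (r * z) * e.snd i
    rw [Finset.sum_mul]
    refine Finset.sum_congr rfl fun i _ => ?_
    rw [mul_assoc, center_comm]
    simp only [mul_assoc])

/-- The biadditive map `(r, r') ↦ λ(r) ρ(r')`. -/
def lambdaRho : centraliser f →+ centraliser f →+ StarEnd e :=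
  AddMonoidHom.mk' (fun r => AddMonoidHom.mk'
      (fun r' => (⟨(AddMonoidHom.mulLeft (r : A)).comp (AddMonoidHom.mulRight (r' : A)),
        fun b x => ⟨by
          change r * (f b * x * r') = f b * (r * (x * r'))
          rw [← mul_assoc (f b), centraliser_comm]; simp only [mul_assoc], by
          change r * (x * f b * r') = r * (x * r') * f b
          rw [mul_assoc x, centraliser_comm]; simp only [mul_assoc]⟩⟩ : bimodEnd f))
      fun r r' => StarEnd.ext_apply (e := e) fun x => by
        change _ * (x * ((r + r' : centraliser f) : A)) = _ * (x * r) + _ * (x * r')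
        rw [Subring.coe_add, mul_add, mul_add])
    fun r r' => AddMonoidHom.ext fun s => StarEnd.ext_apply (e := e) fun x => by
      change ((r + r' : centraliser f) : A) * (x * s) = r * (x * s) + r' * (x * s)
      rw [Subring.coe_add, add_mul]

theorem lambdaRho_apply (r r' : centraliser f) (x : A) : lambdaRho e r r' x = r * (x * r') := rfl

theorem lambdaRho_left (α : StarEnd e) (r r' : centraliser f) :
    lambdaRho e ((leftStarMod e).act α r) r' = α * lambdaRho e r r' := by
  refine StarEnd.ext_apply fun x => ?_
  rw [StarEnd.mul_apply, lambdaRho_apply, leftStarMod_act, ← mul_assoc, ← e.sum_fst_move,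
    Finset.sum_mul]
  simp only [lambdaRho_apply, mul_assoc]

theorem lambdaRho_right (r r' : centraliser f) (α : StarEnd e) :
    lambdaRho e r ((rightStarMod e).act r' α) = lambdaRho e r r' * α := by
  refine StarEnd.ext_apply fun x => ?_
  rw [StarEnd.mul_apply, lambdaRho_apply, rightStarMod_act, ← e.sum_snd_move, Finset.mul_sum]
  have h := e.sum_sandwich (bimodEndId f) α.toBimodEnd r' 1 1 x
  simp only [one_mul, mul_one] at h
  change ∑ i, x * e.fst i * r' * α (e.snd i) = ∑ i, e.fst i * r' * α (e.snd i * x) at h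
  rw [← Finset.mul_sum, ← h, Finset.mul_sum]
  simp only [lambdaRho_apply, mul_assoc]

/-- The biadditive map `(r, r') ↦ ∑ e¹ r r' e²`. -/
def tracePairing : centraliser f →+ centraliser f →+ Subring.center A :=
  AddMonoidHom.mk' (fun r => AddMonoidHom.mk'
      (fun r' => (⟨∑ i, e.fst i * (r * r') * e.snd i, Subring.mem_center_iff.2
        (e.sum_move_center (r * r'))⟩ : Subring.center A))
      fun r r' => Subtype.ext (by simp [mul_add, add_mul, Finset.sum_add_distrib]))
    fun r r' => AddMonoidHom.ext fun s => Subtype.ext (by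
      simp [mul_add, add_mul, Finset.sum_add_distrib])

theorem tracePairing_apply (r r' : centraliser f) :
    (tracePairing e r r' : A) = ∑ i, e.fst i * (r * r') * e.snd i := rfl

theorem tracePairing_balanced (r : centraliser f) (α : StarEnd e) (r' : centraliser f) :
    tracePairing e ((rightStarMod e).act r α) r' =
      tracePairing e r ((leftStarMod e).act α r') := by
  refine Subtype.ext ?_
  rw [tracePairing_apply, tracePairing_apply, rightStarMod_act, leftStarMod_act]
  calc ∑ j, e.fst j * ((∑ i, e.fst i * r * α (e.snd i)) * r') * e.snd j
      = ∑ j, (∑ i, e.fst i * r * α (e.snd i * e.fst j)) * r' * e.snd j := by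
        simp only [e.sum_snd_move, ← mul_assoc]
    _ = ∑ i, e.fst i * r * ∑ j, α (e.snd i * e.fst j) * r' * e.snd j := by
        simp only [Finset.sum_mul, Finset.mul_sum]
        rw [Finset.sum_comm]
        simp only [mul_assoc]
    _ = ∑ i, e.fst i * (r * ∑ j, α (e.fst j) * r' * e.snd j) * e.snd i := by
        simp only [e.sum_fst_move]
        simp only [mul_assoc]

theorem lambdaRho_act (w v w' : centraliser f) :
    (leftStarMod e).act (lambdaRho e w v) w' =
      (bimodStarZ e).right.act w (tracePairing e v w') := by
  refine Subtype.ext ?_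
  change ∑ i, w * (e.fst i * v) * w' * e.snd i = w * ∑ i, e.fst i * (v * w') * e.snd i
  rw [Finset.mul_sum]
  simp only [mul_assoc]

theorem act_lambdaRho (v w v' : centraliser f) :
    (bimodZStar e).left.act (tracePairing e v w) v' =
      (rightStarMod e).act v (lambdaRho e w v') := by
  refine Subtype.ext ?_
  change (∑ i, e.fst i * (v * w) * e.snd i) * v' = ∑ i, e.fst i * v * (w * (e.snd i * v'))
  rw [Finset.sum_mul]
  simp only [mul_assoc]

theorem tracePairing_one_one : tracePairing e 1 1 = 1 :=
  Subtype.ext (by simp [tracePairing_apply, e.mul_eq_one])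

theorem bimodZStar_isFirm : (bimodZStar e).IsFirm := by
  refine ⟨LeftMod.isFirm_of_one _ fun x => Subtype.ext (one_mul _),
    RightMod.isFirm_of_dualBasis _ (n := 1) (fun _ => lambdaRho e 1) (fun _ => 1)
      (fun _ x s => lambdaRho_right e 1 x s) fun x => ?_⟩
  rw [Fin.sum_univ_one]
  refine (act_lambdaRho e 1 1 x).symm.trans ?_
  rw [tracePairing_one_one]
  exact Subtype.ext (one_mul _)

theorem bimodStarZ_isFirm : (bimodStarZ e).IsFirm := by
  refine ⟨LeftMod.isFirm_of_dualBasis _ (n := 1) (fun _ => (lambdaRho e).flip 1) (fun _ => 1)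
      (fun _ s x => lambdaRho_left e s x 1) fun x => ?_,
    RightMod.isFirm_of_one _ fun x => Subtype.ext (mul_one _)⟩
  rw [Fin.sum_univ_one]
  refine (lambdaRho_act e x 1 1).trans ?_
  rw [tracePairing_one_one]
  exact Subtype.ext (mul_one _)

/-- The Morita context of a separable depth two extension. -/
def moritaContext (hD2 : IsDepthTwo f) :
    MoritaContext (Subring.center A) (StarEnd e) (centraliser f) (centraliser f) where
  firm_R := isFirmRing_of_one _
  firm_S := isFirmRing_starEnd hD2
  bV := bimodZStar e
  bW := bimodStarZ e
  firm_V := bimodZStar_isFirm e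
  firm_W := bimodStarZ_isFirm e
  σ := BalTensor.lift (lambdaRho e) fun r z r' => StarEnd.ext_apply fun x => by
    change (r * z : A) * (x * r') = r * (x * (z * r'))
    rw [← mul_assoc x, center_comm z x]
    simp only [mul_assoc]
  τ := BalTensor.lift (tracePairing e) (tracePairing_balanced e)
  σ_left s w v := lambdaRho_left e s w v
  σ_right w v s := lambdaRho_right e w v s
  τ_left z v w := Subtype.ext (by
    change ∑ i, e.fst i * (z * v * w) * e.snd i = z * ∑ i, e.fst i * (v * w) * e.snd i
    rw [Finset.mul_sum]
    refine Finset.sum_congr rfl fun i _ => ?_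
    rw [mul_assoc (z : A), ← mul_assoc (e.fst i), center_comm]
    simp only [mul_assoc])
  τ_right v w z := Subtype.ext (by
    change ∑ i, e.fst i * (v * (w * z)) * e.snd i = (∑ i, e.fst i * (v * w) * e.snd i) * z
    rw [Finset.sum_mul]
    refine Finset.sum_congr rfl fun i _ => ?_
    rw [mul_assoc _ (e.snd i), center_comm z (e.snd i)]
    simp only [mul_assoc])
  σ_τ w v w' := lambdaRho_act e w v w'
  τ_σ v w v' := act_lambdaRho e v w v'

theorem moritaContext_τ_bijective (hD2 : IsDepthTwo f) :
    Function.Bijective (moritaContext e hD2).τ := by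
  refine BalTensor.bijective_of_inverse _
    (((tmulHom _ _).flip 1).comp (centerToCentraliser f).toAddMonoidHom) (fun r r' => ?_)
    (fun z => ?_)
  · change mtmul (rightStarMod e) (leftStarMod e) (centerToCentraliser f (tracePairing e r r')) 1 =
      mtmul (rightStarMod e) (leftStarMod e) r r'
    have h₁ : centerToCentraliser f (tracePairing e r r') =
        (rightStarMod e).act r (lambdaRho e r' 1) :=
      (mul_one _).symm.trans (act_lambdaRho e r r' 1)
    have h₂ : (leftStarMod e).act (lambdaRho e r' 1) 1 = r' := by
      rw [lambdaRho_act, tracePairing_one_one]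
      exact Subtype.ext (mul_one _)
    rw [h₁]
    exact (tmul_balanced _ _ r (lambdaRho e r' 1) 1).trans (congrArg _ h₂)
  · refine Subtype.ext ?_
    change ∑ i, e.fst i * (z * 1) * e.snd i = z
    simp only [mul_one, center_comm, mul_assoc]
    rw [← Finset.mul_sum, e.mul_eq_one, mul_one]

/-- The map `α ↦ ∑ α(t¹) t²` from bimodule endomorphisms to the centraliser, for a Casimir
element `t`. -/
def evalCasimir (t : ExtTensor f) (ht : IsCasimir f t) : StarEnd e →+ centraliser f :=
  AddMonoidHom.mk' (fun α => ⟨StarEnd.contractRight t (fun b => ht (f b)) α 1,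
    mem_centraliser fun b => by
      rw [← StarEnd.map_mul_left, ← StarEnd.map_mul_right, one_mul, mul_one]⟩)
    fun α β => Subtype.ext (by rw [map_add]; rfl)

theorem evalCasimir_apply (t : ExtTensor f) (ht : IsCasimir f t) (α : StarEnd e) :
    (evalCasimir e t ht α : A) = sandwich α.toBimodEnd (bimodEndId f) 1 1 1 t := rfl

/-- The map `v ↦ ∑ t¹ v t²` from the centraliser to the centre, for a Casimir element `t`. -/
def casimirTrace (t : ExtTensor f) (ht : IsCasimir f t) (v : centraliser f) : Subring.center A :=
  ⟨sandwich (bimodEndId f) (bimodEndId f) v 1 1 t, Subring.mem_center_iff.2 fun a => by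
    rw [← sandwich_mul_left (bimodEndId f) (bimodEndId f) v 1 1 a (bimodEndId f) a
        (fun x => by simp [bimodEndId]),
      ← sandwich_mul_right (bimodEndId f) (bimodEndId f) v 1 1 a (bimodEndId f) a
        (fun x => by simp [bimodEndId])]
    have h := congrArg (sandwich (bimodEndId f) (bimodEndId f) v 1 1) (ht a)
    rwa [sandwich_lact, sandwich_ract, one_mul, mul_one] at h⟩

theorem evalCasimir_lambdaRho (t : ExtTensor f) (ht : IsCasimir f t) (w v : centraliser f) :
    evalCasimir e t ht (lambdaRho e w v) = (bimodStarZ e).right.act w (casimirTrace t ht v) := by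
  refine Subtype.ext ?_
  refine DFunLike.congr_fun (f := sandwich (lambdaRho e w v).toBimodEnd (bimodEndId f) 1 1 1)
    (g := (AddMonoidHom.mulLeft (w : A)).comp (sandwich (bimodEndId f) (bimodEndId f) v 1 1))
    (BalTensor.addHom_ext fun a a' => ?_) t
  change w * (1 * a * v) * 1 * (a' * 1) = w * (1 * a * v * (a' * 1))
  simp only [one_mul, mul_one, mul_assoc]

theorem moritaContext_σ_bijective (hD2 : IsDepthTwo f) (hH : IsHSeparable f) :
    Function.Bijective (moritaContext e hD2).σ := by
  obtain ⟨n, c, r, hc, h1⟩ := hH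
  refine BalTensor.bijective_of_inverse _
    (∑ k, ((tmulHom _ _).flip (r k)).comp (evalCasimir e (c k) (hc k))) (fun w v => ?_)
    (fun α => StarEnd.ext_apply fun x => ?_)
  · change (∑ k, ((tmulHom _ _).flip (r k)).comp (evalCasimir e (c k) (hc k)))
      (lambdaRho e w v) = tmulHom _ _ w v
    have hv : v = ∑ k, (bimodZStar e).left.act (casimirTrace (c k) (hc k) v) (r k) := by
      refine Subtype.ext ?_
      have h := congrArg (sandwich (bimodEndId f) (bimodEndId f) v 1 1) h1
      rw [map_sum] at h
      simp only [sandwich_ract] at h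
      change (1 * 1 * v * (1 * 1) : A) = _ at h
      simp only [one_mul, mul_one] at h
      rw [h, AddSubmonoidClass.coe_finsetSum]
      exact Finset.sum_congr rfl fun k _ =>
        sandwich_mul_right _ _ _ _ _ _ _ _ (fun a => by simp [bimodEndId]) _
    conv_rhs => rw [hv, map_sum]
    rw [AddMonoidHom.finsetSum_apply]
    refine Finset.sum_congr rfl fun k _ => ?_
    rw [AddMonoidHom.comp_apply, evalCasimir_lambdaRho]
    exact tmul_balanced _ _ w (casimirTrace (c k) (hc k) v) (r k)
  · rw [AddMonoidHom.finsetSum_apply, map_sum, StarEnd.sum_apply]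
    change ∑ k, (evalCasimir e (c k) (hc k) α : A) * (x * r k) = α x
    have h := congrArg (sandwich α.toBimodEnd (bimodEndId f) 1 x 1) h1
    rw [map_sum] at h
    simp only [sandwich_ract] at h
    change α (x * 1) * 1 * (1 * 1) = _ at h
    simp only [mul_one] at h
    rw [h]
    refine Finset.sum_congr rfl fun k _ => ?_
    have hx := congrArg (sandwich α.toBimodEnd (bimodEndId f) 1 1 (r k)) (hc k x)
    rw [sandwich_lact, sandwich_ract, one_mul] at hx
    rw [hx, evalCasimir_apply]
    exact (sandwich_mul_right _ _ _ _ _ _ _ _ (fun a => by simp [bimodEndId]) _).symm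

end Context

end D2Morita

theorem mainTheorem12 {B A : Type*} [Ring B] [Ring A] (f : B →+* A)
    (hD2 : D2Morita.IsDepthTwo f) (e : D2Morita.SeparabilityElement f) :
    ∃ K : D2Morita.MoritaContext (Subring.center A) (D2Morita.StarEnd e)
        (D2Morita.centraliser f) (D2Morita.centraliser f),
      (∀ z r, (K.bV.left.act z r : A) = z * r) ∧
      (∀ r α, (K.bV.right.act r α : A) = ∑ i, e.fst i * r * α (e.snd i)) ∧
      (∀ α r, (K.bW.left.act α r : A) = ∑ i, α (e.fst i) * r * e.snd i) ∧
      (∀ r z, (K.bW.right.act r z : A) = r * z) ∧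
      (∀ r r' : D2Morita.centraliser f,
        (K.σ (D2Morita.mtmul _ _ r r')).toHom =
            (AddMonoidHom.mulLeft (r : A)).comp (AddMonoidHom.mulRight (r' : A)) ∧
        (K.σ (D2Morita.mtmul _ _ r r')).toHom =
            (AddMonoidHom.mulRight (r' : A)).comp (AddMonoidHom.mulLeft (r : A))) ∧
      (∀ r r' : D2Morita.centraliser f,
        (K.τ (D2Morita.mtmul _ _ r r') : A) = ∑ i, e.fst i * (r * r') * e.snd i) ∧
      Function.Bijective K.τ ∧
      (D2Morita.IsHSeparable f → K.IsStrict) := by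
  refine ⟨D2Morita.moritaContext e hD2, fun _ _ => rfl, fun _ _ => rfl, fun _ _ => rfl,
    fun _ _ => rfl, fun r r' => ⟨rfl, AddMonoidHom.ext fun x => (mul_assoc _ _ _).symm⟩,
    fun _ _ => rfl, D2Morita.moritaContext_τ_bijective e hD2, fun hH =>
    ⟨D2Morita.moritaContext_σ_bijective e hD2 hH, D2Morita.moritaContext_τ_bijective e hD2⟩⟩
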